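/- **Theorem.** Let $n\ge 2$. For $\lambda=(\lambda_1,\dots,\lambda_n)\in\mathbb C^n$ and an integer $m\ge 2$ put $$\Omega(\lambda,m)=\min\{|\lambda_1^{k_1}\cdots\lambda_n^{k_n}-\lambda_j| : k\in\mathbb Z_{\ge 0}^n,\ 2\le k_1+\dots+k_n\le m,\ 1\le j\le n\}.$$ We say that $\lambda$ satisfies the Brjuno condition if $$\sum_{j=1}^\infty \frac1{2^j}\log\frac1{\Omega(\lambda,2^j)}<\infty ,$$ where $\log(1/0)=+\infty$, and we let $E\subset\mathbb C^n$ be the set of all $\lambda$ that do not satisfy it. For $\sigma>0$ let $k_\sigma(z,\xi)=\dfrac{|\log\|z-\xi\||^\sigma}{\|z-\xi\|^{2n-2}}$ for $z\neq\xi$ in $\mathbb C^n$ (Euclidean norm) and $k_\sigma(z,z)=+\infty$. For a compact set $K\subset\mathbb C^n$ let $C_\sigma(K)=1/W(K)$, where $W(K)\in[0,+\infty]$ is the infimum of $\iint k_\sigma(z,\xi)\,d\mu(\xi)\,d\mu(z)$ over all Borel probability measures $\mu$ supported in $K$ (with $W(\emptyset)=+\infty$, $1/\infty=0$). For an arbitrary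 set $A\subset\mathbb C^n$ let $\underline C_\sigma(A)=\sup\{C_\sigma(K):K\subset A\text{ compact}\}$ and $\overline C_\sigma(A)=\inf\{\underline C_\sigma(G):G\supset A\text{ open}\}$; $A$ has zero $C_\sigma$-capacity if $\underline C_\sigma(A)=\overline C_\sigma(A)=0$. For a gauge $h$ with $h(0)=0$, let $H^h(A)=\lim_{\varepsilon\to0+}H^h(A,\varepsilon)$, where $H^h(A,\varepsilon)$ is the infimum of $\sum_j h(r_j)$ over all countable covers of $A$ by open balls of radii $r_j<\varepsilon$. Then $E$ has zero $C_\sigma$-capacity for every $\sigma>n$. In particular, $H^{h_\delta}(E)=0$ for $h_\delta(t)=t^{2n-2}|\log t|^{-\delta}$ and every $\delta>n+1$. -/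

import Mathlib

open scoped ENNReal

namespace BrjunoCapacity

/-- The value `Ω(λ, m)`: the minimum of `|λ^k - λ_j|` over multi-indices `k ∈ ℕⁿ` with
`2 ≤ |k| ≤ m` and over `1 ≤ j ≤ n`. For `n ≥ 1` and `m ≥ 2` the set is finite and nonempty,
so the infimum is a minimum, see `isLeast_Omega`. -/
noncomputable def Omega {n : ℕ} (lam : EuclideanSpace ℂ (Fin n)) (m : ℕ) : ℝ :=
  sInf {x : ℝ | ∃ (k : Fin n → ℕ) (j : Fin n),
    2 ≤ ∑ i, k i ∧ ∑ i, k i ≤ m ∧ x = ‖(∏ i, lam i ^ k i) - lam j‖}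

theorem isLeast_Omega {n : ℕ} (hn : 1 ≤ n) (lam : EuclideanSpace ℂ (Fin n)) {m : ℕ}
    (hm : 2 ≤ m) :
    IsLeast {x : ℝ | ∃ (k : Fin n → ℕ) (j : Fin n),
      2 ≤ ∑ i, k i ∧ ∑ i, k i ≤ m ∧ x = ‖(∏ i, lam i ^ k i) - lam j‖} (Omega lam m) := by
  have hfin : ({x : ℝ | ∃ (k : Fin n → ℕ) (j : Fin n),
      2 ≤ ∑ i, k i ∧ ∑ i, k i ≤ m ∧ x = ‖(∏ i, lam i ^ k i) - lam j‖}).Finite := by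
    refine ((((Set.finite_Iic (fun _ : Fin n => m)).prod
      (Set.finite_univ (α := Fin n))).image
      (fun p => ‖(∏ i, lam i ^ p.1 i) - lam p.2‖))).subset ?_
    rintro x ⟨k, j, -, hk, rfl⟩
    exact ⟨(k, j), ⟨fun i => (Finset.single_le_sum (fun _ _ => Nat.zero_le _)
      (Finset.mem_univ i)).trans hk, Set.mem_univ _⟩, rfl⟩
  refine ⟨Set.Nonempty.csInf_mem ?_ hfin, fun x hx => csInf_le hfin.bddBelow hx⟩
  exact ⟨_, Pi.single ⟨0, hn⟩ 2, ⟨0, hn⟩, by simp, by simpa using hm, rfl⟩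

/-- The Brjuno condition `∑_{j ≥ 1} 2^{-j} log (1 / Ω(λ, 2^j)) < ∞`, where `log (1 / 0) = +∞`:
no `Ω(λ, 2^j)` vanishes, and the series of real numbers converges. (Since `Ω(λ, ·)` is
nonincreasing, `log (1 / Ω(λ, 2^j))` is bounded below, so the only alternative to convergence is
divergence to `+∞`.) -/
def Brjuno {n : ℕ} (lam : EuclideanSpace ℂ (Fin n)) : Prop :=
  (∀ j : ℕ, 1 ≤ j → Omega lam (2 ^ j) ≠ 0) ∧
    Summable fun j : ℕ => (1 / 2 ^ (j + 1) : ℝ) * Real.log (1 / Omega lam (2 ^ (j + 1)))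

/-- The kernel `|log ‖z - ξ‖|^σ / ‖z - ξ‖^{2n-2}`, with value `+∞` on the diagonal. -/
noncomputable def kernel {n : ℕ} (σ : ℝ) (z ξ : EuclideanSpace ℂ (Fin n)) : ℝ≥0∞ :=
  open scoped Classical in
  if z = ξ then ⊤
  else ENNReal.ofReal (|Real.log ‖z - ξ‖| ^ σ / ‖z - ξ‖ ^ (2 * n - 2))

/-- The potential `U^μ(z)`. -/
noncomputable def potential {n : ℕ} (σ : ℝ)
    (μ : MeasureTheory.Measure (EuclideanSpace ℂ (Fin n))) (z : EuclideanSpace ℂ (Fin n)) :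
    ℝ≥0∞ :=
  ∫⁻ ξ, kernel σ z ξ ∂μ

/-- The energy `I(μ)`. -/
noncomputable def energy {n : ℕ} (σ : ℝ)
    (μ : MeasureTheory.Measure (EuclideanSpace ℂ (Fin n))) : ℝ≥0∞ :=
  ∫⁻ z, potential σ μ z ∂μ

/-- The infimum `W(K)` of the energies of the Borel probability measures carried by `K`
(it is `+∞` if there are none). -/
noncomputable def minEnergy {n : ℕ} (σ : ℝ) (K : Set (EuclideanSpace ℂ (Fin n))) : ℝ≥0∞ :=
  ⨅ (μ : MeasureTheory.Measure (EuclideanSpace ℂ (Fin n)))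
    (_ : MeasureTheory.IsProbabilityMeasure μ) (_ : μ Kᶜ = 0), energy σ μ

/-- The `C_σ`-capacity `1 / W(K)` of a compact set `K`. -/
noncomputable def compactCapacity {n : ℕ} (σ : ℝ) (K : Set (EuclideanSpace ℂ (Fin n))) :
    ℝ≥0∞ :=
  (minEnergy σ K)⁻¹

/-- The inner `C_σ`-capacity. -/
noncomputable def innerCapacity {n : ℕ} (σ : ℝ) (E : Set (EuclideanSpace ℂ (Fin n))) : ℝ≥0∞ :=
  ⨆ (K : Set (EuclideanSpace ℂ (Fin n))) (_ : IsCompact K) (_ : K ⊆ E), compactCapacity σ K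

/-- The outer `C_σ`-capacity. -/
noncomputable def outerCapacity {n : ℕ} (σ : ℝ) (E : Set (EuclideanSpace ℂ (Fin n))) : ℝ≥0∞ :=
  ⨅ (G : Set (EuclideanSpace ℂ (Fin n))) (_ : IsOpen G) (_ : E ⊆ G), innerCapacity σ G

/-- `H^h(E, ε)`: the infimum of `∑ h(r_j)` over the countable covers of `E` by open balls
`B(x_j, r_j)` with `r_j < ε`. A ball of radius `0` is empty, and the gauges have `h(0) = 0`,
so finite covers are included. -/
noncomputable def hausdorffContent {X : Type*} [PseudoMetricSpace X] (h : ℝ → ℝ) (E : Set X)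
    (ε : ℝ) : ℝ≥0∞ :=
  ⨅ (x : ℕ → X) (r : ℕ → ℝ) (_ : ∀ j, 0 ≤ r j ∧ r j < ε) (_ : E ⊆ ⋃ j, Metric.ball (x j) (r j)),
    ∑' j, ENNReal.ofReal (h (r j))

/-- The `h`-Hausdorff measure `H^h(E) = lim_{ε → 0+} H^h(E, ε)`; as `H^h(E, ε)` increases
when `ε` decreases, the limit is the supremum over `ε > 0`. -/
noncomputable def hausdorffMeasure {X : Type*} [PseudoMetricSpace X] (h : ℝ → ℝ) (E : Set X) :
    ℝ≥0∞ :=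
  ⨆ (ε : ℝ) (_ : 0 < ε), hausdorffContent h E ε

/-- The gauge `h_δ(t) = t^{2n-2} |log t|^{-δ}` (used for small `t`; its value at `0` is `0`
when `n ≥ 2`). -/
noncomputable def gauge (n : ℕ) (δ : ℝ) (t : ℝ) : ℝ :=
  t ^ (2 * n - 2) * |Real.log t| ^ (-δ)

end BrjunoCapacity

/-!
For each `β < 1`, small divisors satisfying `|λ^k - λ_i| ≥ exp (-O(|k| ^ β + L))` for all `k` and
`i` imply the Brjuno condition (`brjuno_of_exp_neg_le`). Hence the exceptional set is covered, for
every `L`, by the tubes `|λ^k - λ_i| < e^{-3M}` with `M ≥ |k| ^ β + L`. Resonances need no separate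
treatment: an exact equality `λ^k = λ_i` belongs to the tube of `(k, i)` for every `L`.

On a region `1 / R < |λ_j| < R` the resonance equation becomes linear in logarithmic
coordinates: `∑ K_j w_j ∈ 2 π i ℤ` with `K = k - e_i`. Only `O(|k|)` of these hyperplanes are
relevant, and each is a graph with a Lipschitz constant independent of `k`. So for every `s` not
much smaller than the width of the tube, the tube is covered by `O(|k|) s^{-(2n-2)}` sets of
diameter `s` (`exists_scaleCover_resonance`). The points with a vanishing coordinate lie in tubes
around coordinate hyperplanes, which have the same kind of covers.

Covering numbers control energies. The kernel `k_σ` dominates a sum, over the scales `e^{-l}`, of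
`l ^ σ e^{l (2n-2)}` times the indicator function of `‖z - ξ‖ < e^{-l}`. A probability measure
carried by `N` sets of diameter less than `e^{-l}` gives mass at least `1 / (4 N)` to the pairs of
points at distance less than `e^{-l}`. If `N ≤ A e^{l (2n-2)}` for `M ≤ l ≤ 2 M`, each of these scales
contributes a multiple of `M ^ σ / A`, so that the energy is at least a multiple of
`M ^ (σ + 1) / A` (`ScaleCover.le_energy`). With capacity countably subadditive
(`inv_le_energy_of_iUnion`), the capacity of the union of the tubes is at most a multiple of
`∑ |k| / M ^ (σ + 1)`. There are `O(m ^ (n - 1))` multi-indices with `|k| = m`, so the sum converges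
as soon as `β (σ + 1) > n + 1`, and it tends to `0` as `L → ∞`. A suitable `β < 1` exists exactly
when `σ > n`.

The covers at the scale `e^{-M}` bound the Hausdorff content for the gauge `h_δ` by a multiple of
`∑ |k| / M ^ δ`. The two conclusions are therefore the cases `p = σ + 1` and `p = δ` of a single
statement about `∑ A / M ^ p` (`TubeNull`, `tubeNull_setOf_not_brjuno`).
-/

open MeasureTheory Set

namespace BrjunoCapacity

/-! ### Covers at all scales of a range, and lower bounds for energies -/

/-- `T` can be covered, for each scale `e^{-l}` with `M ≤ l ≤ 2 M`, by at most `A e^{l d}` sets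
whose points are at mutual distance less than `e^{-l}`: down to the scale `e^{-2M}`, the set `T`
looks like a set of dimension `d` and of volume comparable to `A`. -/
def ScaleCover {X : Type*} [PseudoMetricSpace X] (d : ℕ) (A : ℝ) (M : ℕ) (T : Set X) : Prop :=
  ∀ l : ℕ, M ≤ l → l ≤ 2 * M → ∃ P : Finset (Set X), T ⊆ ⋃₀ (P : Set (Set X)) ∧
    (∀ Q ∈ P, ∀ x ∈ Q, ∀ y ∈ Q, dist x y < Real.exp (-l)) ∧
    (P.card : ℝ) ≤ A * Real.exp (l * d)

/-- If `N` sets of diameter less than `s` cover the support of a probability measure `μ`, then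
the pairs of points at distance less than `s` have `μ × μ`-measure at least `1 / (4 N)`: the points
whose ball has measure less than `1 / (2 N)` form a set of measure at most `1 / 2`. -/
lemma inv_card_le_lintegral_ball {X : Type*} [PseudoMetricSpace X] [SecondCountableTopology X]
    [MeasurableSpace X] [OpensMeasurableSpace X] (μ : Measure X) [IsProbabilityMeasure μ]
    {T : Set X} (hT : μ Tᶜ = 0) {s : ℝ} (P : Finset (Set X)) (hP : T ⊆ ⋃₀ (P : Set (Set X)))
    (hd : ∀ Q ∈ P, ∀ x ∈ Q, ∀ y ∈ Q, dist x y < s) :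
    (4 * (P.card : ℝ≥0∞))⁻¹ ≤ ∫⁻ z, μ (Metric.ball z s) ∂μ := by
  have hmeas : Measurable fun z => μ (Metric.ball z s) := by
    have h : MeasurableSet {p : X × X | dist p.2 p.1 < s} :=
      (isOpen_lt (by fun_prop) (by fun_prop)).measurableSet
    exact measurable_measure_prodMk_left h
  set c : ℝ≥0∞ := (2 * (P.card : ℝ≥0∞))⁻¹ with hc
  set G : Set X := {z | c ≤ μ (Metric.ball z s)} with hG
  have hGm : MeasurableSet G := measurableSet_le measurable_const hmeas
  have hpiece : ∀ Q ∈ P, μ (Q ∩ Gᶜ) ≤ c := by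
    intro Q hQ
    rcases (Q ∩ Gᶜ).eq_empty_or_nonempty with h | ⟨z, hz, hzG⟩
    · simp [h]
    · have hz' : μ (Metric.ball z s) < c := by simpa [hG] using hzG
      refine (measure_mono ?_).trans hz'.le
      exact fun x hx => hd Q hQ x hx.1 z hz
  have hbad : μ Gᶜ ≤ 2⁻¹ := by
    have hsub : Gᶜ ⊆ Tᶜ ∪ ⋃ Q ∈ P, (Q ∩ Gᶜ) := by
      intro x hx
      by_cases hxT : x ∈ T
      · obtain ⟨Q, hQ, hxQ⟩ := hP hxT
        exact Or.inr (mem_biUnion (by simpa using hQ) ⟨hxQ, hx⟩)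
      · exact Or.inl hxT
    calc μ Gᶜ ≤ μ Tᶜ + μ (⋃ Q ∈ P, (Q ∩ Gᶜ)) := (measure_mono hsub).trans (measure_union_le _ _)
      _ ≤ 0 + ∑ Q ∈ P, c := by
        gcongr
        · exact hT.le
        · exact (measure_biUnion_finset_le _ _).trans (Finset.sum_le_sum hpiece)
      _ = (P.card : ℝ≥0∞) * c := by simp
      _ ≤ 2⁻¹ := by
        rw [hc, ENNReal.mul_inv (by simp) (by simp), mul_left_comm]
        exact mul_le_of_le_one_right' (ENNReal.mul_inv_le_one _)
  have hgood : 2⁻¹ ≤ μ G := by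
    have h1 := prob_add_prob_compl (μ := μ) hGm
    by_contra! h
    have : μ G + μ Gᶜ < 2⁻¹ + 2⁻¹ := ENNReal.add_lt_add_of_lt_of_le (by finiteness) h hbad
    rw [h1, ENNReal.inv_two_add_inv_two] at this
    exact this.false
  calc (4 * (P.card : ℝ≥0∞))⁻¹ = c * 2⁻¹ := by
        rw [hc, ← ENNReal.mul_inv (by simp) (by simp)]
        congr 1; rw [mul_right_comm]; norm_num
    _ ≤ c * μ G := by gcongr
    _ ≤ _ := mul_meas_ge_le_lintegral hmeas c

lemma sum_exp_le {d : ℕ} (hd : 1 ≤ d) (m : ℕ) :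
    ∑ l ∈ Finset.range (m + 1), Real.exp (l * d) ≤ 2 * Real.exp (m * d) := by
  induction m with
  | zero => simp
  | succ m ih =>
    rw [Finset.sum_range_succ]
    have h2 : (2 : ℝ) ≤ Real.exp d := by
      have := Real.add_one_le_exp (d : ℝ)
      have : (1 : ℝ) ≤ d := by exact_mod_cast hd
      linarith
    have : Real.exp ((m + 1 : ℕ) * d) = Real.exp (m * d) * Real.exp d := by
      rw [← Real.exp_add]; congr 1; push_cast; ring
    have := Real.exp_pos ((m : ℝ) * d)
    nlinarith

/-- The kernel dominates a sum of multiples of indicator functions of small balls. -/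
lemma sum_indicator_ball_le_kernel {n : ℕ} (hn : 2 ≤ n) {σ : ℝ} (hσ : 0 ≤ σ) (M : ℕ)
    (z ξ : EuclideanSpace ℂ (Fin n)) :
    ∑ l ∈ Finset.Ico M (2 * M), ENNReal.ofReal ((M : ℝ) ^ σ / 2 * Real.exp (l * (2 * n - 2 : ℕ))) *
      (Metric.ball z (Real.exp (-(l : ℝ)))).indicator 1 ξ ≤ kernel σ z ξ := by
  classical
  unfold kernel
  split_ifs with hzx
  · exact le_top
  have ht : 0 < ‖z - ξ‖ := norm_pos_iff.2 (sub_ne_zero.2 hzx)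
  set t := ‖z - ξ‖ with htd
  set S := (Finset.Ico M (2 * M)).filter (fun l : ℕ => t < Real.exp (-(l : ℝ))) with hS
  have hterm : ∀ l : ℕ, ENNReal.ofReal ((M : ℝ) ^ σ / 2 * Real.exp (l * (2 * n - 2 : ℕ))) *
      (Metric.ball z (Real.exp (-(l : ℝ)))).indicator 1 ξ =
      if t < Real.exp (-(l : ℝ)) then
        ENNReal.ofReal ((M : ℝ) ^ σ / 2 * Real.exp (l * (2 * n - 2 : ℕ))) else 0 := by
    intro l
    simp [indicator_apply, dist_comm ξ z, dist_eq_norm, htd]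
  simp_rw [hterm]
  rw [← Finset.sum_filter, ← ENNReal.ofReal_sum_of_nonneg (fun _ _ => by positivity)]
  apply ENNReal.ofReal_le_ofReal
  rcases S.eq_empty_or_nonempty with h | h
  · rw [← hS, h]; simp only [Finset.sum_empty]; positivity
  have hmem := S.max'_mem h
  set m := S.max' h with hm
  rw [hS, Finset.mem_filter, Finset.mem_Ico] at hmem
  obtain ⟨⟨hMm, -⟩, htm⟩ := hmem
  have hlog : (M : ℝ) ≤ |Real.log t| := by
    have h1 : Real.log t ≤ -(m : ℝ) := by
      rw [← Real.log_exp (-(m : ℝ))]; exact Real.log_le_log ht htm.le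
    have h2 : (M : ℝ) ≤ m := by exact_mod_cast hMm
    have := neg_le_abs (Real.log t)
    linarith
  calc ∑ l ∈ S, (M : ℝ) ^ σ / 2 * Real.exp (l * (2 * n - 2 : ℕ))
      ≤ ∑ l ∈ Finset.range (m + 1), (M : ℝ) ^ σ / 2 * Real.exp (l * (2 * n - 2 : ℕ)) := by
        refine Finset.sum_le_sum_of_subset_of_nonneg ?_ (fun _ _ _ => by positivity)
        intro l hl
        exact Finset.mem_range.2 (Nat.lt_succ_of_le (S.le_max' l hl))
    _ ≤ (M : ℝ) ^ σ / 2 * (2 * Real.exp (m * (2 * n - 2 : ℕ))) := by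
        rw [← Finset.mul_sum]
        gcongr
        exact sum_exp_le (by omega) m
    _ = (M : ℝ) ^ σ / Real.exp (-(m : ℝ)) ^ (2 * n - 2) := by
        rw [← Real.exp_nat_mul, div_eq_mul_inv _ (Real.exp _), ← Real.exp_neg]
        ring_nf
    _ ≤ |Real.log t| ^ σ / t ^ (2 * n - 2) := by gcongr

/-- The energy of a probability measure carried by a set of dimension `2 n - 2` down to the
scale `e^{-2M}`: each of the `M` scales contributes a multiple of `M ^ σ / A`. -/
lemma ScaleCover.le_energy {n : ℕ} (hn : 2 ≤ n) {σ : ℝ} (hσ : 0 ≤ σ) {A : ℝ} (hA : 0 < A)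
    {M : ℕ} (hM : 1 ≤ M) {T : Set (EuclideanSpace ℂ (Fin n))}
    (hT : ScaleCover (2 * n - 2) A M T) (μ : Measure (EuclideanSpace ℂ (Fin n)))
    [IsProbabilityMeasure μ] (hμ : μ Tᶜ = 0) :
    ENNReal.ofReal ((M : ℝ) ^ (σ + 1) / (8 * A)) ≤ energy σ μ := by
  have hM0 : (0 : ℝ) < M := by exact_mod_cast hM
  set c : ℕ → ℝ := fun l => (M : ℝ) ^ σ / 2 * Real.exp (l * (2 * n - 2 : ℕ)) with hc
  have hball : ∀ l : ℕ, Measurable fun z : EuclideanSpace ℂ (Fin n) =>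
      μ (Metric.ball z (Real.exp (-(l : ℝ)))) := by
    intro l
    have h : MeasurableSet {p : EuclideanSpace ℂ (Fin n) × EuclideanSpace ℂ (Fin n) |
        dist p.2 p.1 < Real.exp (-(l : ℝ))} :=
      (isOpen_lt (by fun_prop) (by fun_prop)).measurableSet
    exact measurable_measure_prodMk_left h
  have hpot : ∀ z, ∑ l ∈ Finset.Ico M (2 * M), ENNReal.ofReal (c l) *
      μ (Metric.ball z (Real.exp (-(l : ℝ)))) ≤ potential σ μ z := by
    intro z
    refine le_trans (le_of_eq ?_)
      (lintegral_mono fun ξ => sum_indicator_ball_le_kernel hn hσ M z ξ)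
    rw [lintegral_finsetSum _ fun l _ =>
      (measurable_one.indicator Metric.isOpen_ball.measurableSet).const_mul _]
    refine Finset.sum_congr rfl fun l _ => ?_
    rw [lintegral_const_mul _ (measurable_one.indicator Metric.isOpen_ball.measurableSet),
      lintegral_indicator_one Metric.isOpen_ball.measurableSet]
  have hscale : ∀ l ∈ Finset.Ico M (2 * M), ENNReal.ofReal ((M : ℝ) ^ σ / (8 * A)) ≤
      ENNReal.ofReal (c l) * ∫⁻ z, μ (Metric.ball z (Real.exp (-(l : ℝ)))) ∂μ := by
    intro l hl
    rw [Finset.mem_Ico] at hl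
    obtain ⟨P, hP, hd, hcard⟩ := hT l hl.1 hl.2.le
    have h1 := inv_card_le_lintegral_ball μ hμ P hP hd
    have h2 : ENNReal.ofReal ((4 * (A * Real.exp (l * (2 * n - 2 : ℕ))))⁻¹) ≤
        (4 * (P.card : ℝ≥0∞))⁻¹ := by
      rw [ENNReal.ofReal_inv_of_pos (by positivity), ENNReal.inv_le_inv]
      calc (4 * (P.card : ℝ≥0∞)) = ENNReal.ofReal (4 * (P.card : ℝ)) := by
            rw [ENNReal.ofReal_mul (by norm_num)]; simp
        _ ≤ _ := by gcongr
    calc ENNReal.ofReal ((M : ℝ) ^ σ / (8 * A))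
        = ENNReal.ofReal (c l) *
          ENNReal.ofReal ((4 * (A * Real.exp (l * (2 * n - 2 : ℕ))))⁻¹) := by
          rw [← ENNReal.ofReal_mul (by simp only [hc]; positivity)]
          congr 1
          have := Real.exp_ne_zero (l * (2 * n - 2 : ℕ))
          simp only [hc]
          field_simp
          norm_num
      _ ≤ _ := by gcongr; exact h2.trans h1
  calc ENNReal.ofReal ((M : ℝ) ^ (σ + 1) / (8 * A))
      = ∑ l ∈ Finset.Ico M (2 * M), ENNReal.ofReal ((M : ℝ) ^ σ / (8 * A)) := by
        rw [Finset.sum_const, Nat.card_Ico, nsmul_eq_mul, two_mul, Nat.add_sub_cancel,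
          Real.rpow_add_one hM0.ne', ← ENNReal.ofReal_natCast,
          ← ENNReal.ofReal_mul (by positivity)]
        congr 1; ring
    _ ≤ ∑ l ∈ Finset.Ico M (2 * M),
        ENNReal.ofReal (c l) * ∫⁻ z, μ (Metric.ball z (Real.exp (-(l : ℝ)))) ∂μ :=
        Finset.sum_le_sum hscale
    _ = ∫⁻ z, ∑ l ∈ Finset.Ico M (2 * M), ENNReal.ofReal (c l) *
        μ (Metric.ball z (Real.exp (-(l : ℝ)))) ∂μ := by
        rw [lintegral_finsetSum _ fun l _ => (hball l).const_mul _]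
        exact Finset.sum_congr rfl fun l _ => (lintegral_const_mul _ (hball l)).symm
    _ ≤ energy σ μ := lintegral_mono hpot

/-! ### Countable subadditivity of capacity -/

lemma energy_smul {n : ℕ} (σ : ℝ) {c : ℝ≥0∞} (hc : c ≠ ∞)
    (μ : Measure (EuclideanSpace ℂ (Fin n))) : energy σ (c • μ) = c ^ 2 * energy σ μ := by
  have h : ∀ z, potential σ (c • μ) z = c * potential σ μ z := fun z => by
    simp [potential]
  simp only [energy, h, lintegral_smul_measure, smul_eq_mul]
  rw [lintegral_const_mul' _ _ hc]; ring

/-- Young's inequality in the form `2 t m ≤ m² / a + t² a`. -/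
lemma two_mul_le_sq_mul_inv_add {m a t : ℝ≥0∞} (hm : m ≠ ∞) (ha : a ≠ ∞) (ha0 : a ≠ 0)
    (ht : t ≠ ∞) : 2 * (t * m) ≤ m ^ 2 * a⁻¹ + t ^ 2 * a := by
  lift m to NNReal using hm
  lift a to NNReal using ha
  lift t to NNReal using ht
  have ha0' : a ≠ 0 := by simpa using ha0
  rw [← ENNReal.coe_inv ha0']
  norm_cast
  rw [← NNReal.coe_le_coe]
  push_cast
  have hpos : (0 : ℝ) < a := by positivity
  have : (m : ℝ) ^ 2 * (a : ℝ)⁻¹ + t ^ 2 * a - 2 * (t * m) = (m - t * a) ^ 2 * (a : ℝ)⁻¹ := by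
    field_simp; ring
  have h2 : 0 ≤ ((m : ℝ) - t * a) ^ 2 * (a : ℝ)⁻¹ := by positivity
  linarith

/-- Countable subadditivity of capacity, in terms of lower bounds for energies. For a
nonnegative kernel the energy of a measure dominates the sum of the energies of its restrictions
to disjoint pieces, and the sum is estimated by Young's inequality. -/
lemma inv_le_energy_of_iUnion {n : ℕ} (σ : ℝ) {ι : Type*} [Countable ι]
    {T : ι → Set (EuclideanSpace ℂ (Fin n))} (hT : ∀ i, MeasurableSet (T i)) {a : ι → ℝ≥0∞}
    (ha0 : ∀ i, a i ≠ 0)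
    (h : ∀ i (ν : Measure (EuclideanSpace ℂ (Fin n))) [IsProbabilityMeasure ν], ν (T i)ᶜ = 0 →
      (a i)⁻¹ ≤ energy σ ν) {ε : ℝ≥0∞} (hε0 : ε ≠ 0) (hε : ε ≠ ∞) (hsum : ∑' i, a i ≤ ε)
    (μ : Measure (EuclideanSpace ℂ (Fin n))) [IsProbabilityMeasure μ]
    (hμ : μ (⋃ i, T i)ᶜ = 0) : ε⁻¹ ≤ energy σ μ := by
  classical
  obtain ⟨e, he⟩ := exists_injective_nat ι
  set P : ι → Set (EuclideanSpace ℂ (Fin n)) :=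
    fun i => T i \ ⋃ j, ⋃ (_ : e j < e i), T j with hP
  have hPm : ∀ i, MeasurableSet (P i) := fun i =>
    (hT i).diff (MeasurableSet.iUnion fun j => MeasurableSet.iUnion fun _ => hT j)
  have hPT : ∀ i, P i ⊆ T i := fun i => sdiff_subset
  have hdisj : Pairwise (Function.onFun Disjoint P) := by
    have key : ∀ i j, e i < e j → Disjoint (P i) (P j) := by
      intro i j hij
      refine Set.disjoint_left.2 fun x hxi hxj => hxj.2 ?_
      exact mem_iUnion.2 ⟨i, mem_iUnion.2 ⟨hij, hPT i hxi⟩⟩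
    intro i j hij
    rcases lt_or_gt_of_ne (he.ne hij) with h | h
    · exact key i j h
    · exact (key j i h).symm
  have hU : ⋃ i, P i = ⋃ i, T i := by
    refine Subset.antisymm (iUnion_mono hPT) fun x hx => ?_
    have hne : ∃ m, ∃ i, e i = m ∧ x ∈ T i := by
      obtain ⟨i, hi⟩ := mem_iUnion.1 hx
      exact ⟨e i, i, rfl, hi⟩
    obtain ⟨i, hi, hxi⟩ := Nat.find_spec hne
    refine mem_iUnion.2 ⟨i, hxi, fun hx' => ?_⟩
    simp only [mem_iUnion] at hx'
    obtain ⟨j, hj, hxj⟩ := hx'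
    exact Nat.find_min hne (hi ▸ hj) ⟨j, rfl, hxj⟩
  have hmass : ∑' i, μ (P i) = 1 := by
    rw [← measure_iUnion hdisj hPm, hU]
    exact (prob_compl_eq_zero_iff (MeasurableSet.iUnion hT)).1 hμ
  have hpiece : ∀ i, μ (P i) ^ 2 * (a i)⁻¹ ≤ ∫⁻ z in P i, potential σ μ z ∂μ := by
    intro i
    by_cases hi : μ (P i) = 0
    · simp [hi]
    have hfin : μ (P i) ≠ ∞ := measure_ne_top _ _
    set ν := (μ (P i))⁻¹ • μ.restrict (P i) with hν
    have hprob : IsProbabilityMeasure ν := ⟨by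
      simp [hν, ENNReal.inv_mul_cancel hi hfin]⟩
    have hsupp : ν (T i)ᶜ = 0 := by
      have : μ.restrict (P i) (T i)ᶜ = 0 := by
        rw [Measure.restrict_apply (hT i).compl]
        convert measure_empty (μ := μ)
        exact (disjoint_compl_left_iff_subset.2 (hPT i)).inter_eq
      simp [hν, this]
    have h1 := h i ν hsupp
    rw [hν, energy_smul _ (ENNReal.inv_ne_top.2 hi)] at h1
    calc μ (P i) ^ 2 * (a i)⁻¹
        ≤ μ (P i) ^ 2 * ((μ (P i))⁻¹ ^ 2 * energy σ (μ.restrict (P i))) := by gcongr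
      _ = energy σ (μ.restrict (P i)) := by
        rw [← mul_assoc, ← mul_pow, ENNReal.mul_inv_cancel hi hfin, one_pow, one_mul]
      _ ≤ _ := by
        refine lintegral_mono fun z => ?_
        exact lintegral_mono' Measure.restrict_le_self le_rfl
  have hE : ∑' i, μ (P i) ^ 2 * (a i)⁻¹ ≤ energy σ μ :=
    calc ∑' i, μ (P i) ^ 2 * (a i)⁻¹ ≤ ∑' i, ∫⁻ z in P i, potential σ μ z ∂μ :=
          ENNReal.tsum_le_tsum hpiece
      _ = ∫⁻ z in ⋃ i, P i, potential σ μ z ∂μ := (lintegral_iUnion hPm hdisj _).symm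
      _ ≤ energy σ μ := setLIntegral_le_lintegral _ _
  have ha : ∀ i, a i ≠ ∞ := fun i =>
    ((ENNReal.le_tsum i).trans hsum).trans_lt hε.lt_top |>.ne
  have hεi : ε⁻¹ ≠ ∞ := ENNReal.inv_ne_top.2 hε0
  -- Young's inequality with the optimal parameter `t = 1 / ε`
  have hY : ε⁻¹ + ε⁻¹ ≤ energy σ μ + ε⁻¹ :=
    calc ε⁻¹ + ε⁻¹ = ∑' i, 2 * (ε⁻¹ * μ (P i)) := by
          rw [ENNReal.tsum_mul_left, ENNReal.tsum_mul_left, hmass, mul_one, two_mul]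
      _ ≤ ∑' i, (μ (P i) ^ 2 * (a i)⁻¹ + ε⁻¹ ^ 2 * a i) := ENNReal.tsum_le_tsum fun i =>
          two_mul_le_sq_mul_inv_add (measure_ne_top _ _) (ha i) (ha0 i) hεi
      _ = ∑' i, μ (P i) ^ 2 * (a i)⁻¹ + ε⁻¹ ^ 2 * ∑' i, a i := by
          rw [ENNReal.tsum_add, ENNReal.tsum_mul_left]
      _ ≤ energy σ μ + ε⁻¹ ^ 2 * ε := by gcongr
      _ = energy σ μ + ε⁻¹ := by
          rw [sq, mul_assoc, ENNReal.inv_mul_cancel hε0 hε, mul_one]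
  exact (ENNReal.add_le_add_iff_right hεi).1 hY

/-! ### Sets that are null for countable covers by tubes -/

/-- `S` has, for every `ε` and `m`, a countable cover by open sets `T i` that have dimension `d`
and volume `A i` down to a scale `M i ≥ m` (in the sense of `ScaleCover`), such that
`∑ A i / (M i) ^ p ≤ ε`. -/
def TubeNull {X : Type*} [PseudoMetricSpace X] (d : ℕ) (p : ℝ) (S : Set X) : Prop :=
  ∀ ε : ℝ≥0∞, ε ≠ 0 → ∀ m : ℕ, ∃ (ι : Type) (_ : Countable ι) (T : ι → Set X) (A : ι → ℝ)
    (M : ι → ℕ), S ⊆ ⋃ i, T i ∧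
    (∀ i, IsOpen (T i) ∧ 0 < A i ∧ m ≤ M i ∧ ScaleCover d (A i) (M i) (T i)) ∧
    ∑' i, ENNReal.ofReal (A i / (M i : ℝ) ^ p) ≤ ε

lemma TubeNull.mono {X : Type*} [PseudoMetricSpace X] {d : ℕ} {p : ℝ} {S S' : Set X}
    (h : TubeNull d p S') (hS : S ⊆ S') : TubeNull d p S := by
  intro ε hε m
  obtain ⟨ι, hι, T, A, M, hST, hT⟩ := h ε hε m
  exact ⟨ι, hι, T, A, M, hS.trans hST, hT⟩

lemma TubeNull.iUnion {X : Type*} [PseudoMetricSpace X] {d : ℕ} {p : ℝ} {κ : Type} [Countable κ]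
    {S : κ → Set X} (h : ∀ k, TubeNull d p (S k)) : TubeNull d p (⋃ k, S k) := by
  intro ε hε m
  obtain ⟨ε', hε'0, hε'⟩ := ENNReal.exists_pos_sum_of_countable hε κ
  have hpos : ∀ k, (ε' k : ℝ≥0∞) ≠ 0 := fun k => by simpa using (hε'0 k).ne'
  choose ι hι T A M hST hT hsum using fun k => h k (ε' k) (hpos k) m
  refine ⟨Σ k, ι k, inferInstance, fun x => T x.1 x.2, fun x => A x.1 x.2, fun x => M x.1 x.2,
    ?_, fun x => hT x.1 x.2, ?_⟩
  · refine iUnion_subset fun k => (hST k).trans (iUnion_subset fun i => ?_)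
    exact subset_iUnion (fun x : Σ k, ι k => T x.1 x.2) ⟨k, i⟩
  · rw [ENNReal.tsum_sigma (fun k i => ENNReal.ofReal (A k i / (M k i : ℝ) ^ p))]
    exact (ENNReal.tsum_le_tsum hsum).trans hε'.le

/-- The union of the tubes in a fine cover is an open set on which every probability measure has
large energy: tube `i` has capacity at most `8 A i / (M i) ^ (σ + 1)`. -/
lemma TubeNull.exists_isOpen_le_energy {n : ℕ} (hn : 2 ≤ n) {σ : ℝ} (hσ : 0 ≤ σ)
    {S : Set (EuclideanSpace ℂ (Fin n))} (hS : TubeNull (2 * n - 2) (σ + 1) S) {ε : ℝ≥0∞}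
    (hε0 : ε ≠ 0) (hε : ε ≠ ∞) : ∃ G, IsOpen G ∧ S ⊆ G ∧
      ∀ (μ : Measure (EuclideanSpace ℂ (Fin n))) [IsProbabilityMeasure μ], μ Gᶜ = 0 →
        ε⁻¹ ≤ energy σ μ := by
  obtain ⟨ι, hι, T, A, M, hST, hT, hsum⟩ := hS (ε / 8) (by simp [hε0]) 1
  refine ⟨⋃ i, T i, isOpen_iUnion fun i => (hT i).1, hST, fun μ _ hμ => ?_⟩
  have hpos : ∀ i, 0 < A i / (M i : ℝ) ^ (σ + 1) := fun i => by
    have h1 : (0 : ℝ) < M i := by exact_mod_cast (hT i).2.2.1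
    have := (hT i).2.1
    positivity
  refine inv_le_energy_of_iUnion σ (fun i => (hT i).1.measurableSet)
    (a := fun i => 8 * ENNReal.ofReal (A i / (M i : ℝ) ^ (σ + 1)))
    (fun i => by simpa using hpos i) (fun i ν _ hν => ?_) hε0 hε ?_ μ hμ
  · refine le_trans (le_of_eq ?_) ((hT i).2.2.2.le_energy hn hσ (hT i).2.1 (hT i).2.2.1 ν hν)
    have h8 : (8 : ℝ≥0∞) = ENNReal.ofReal 8 := by simp
    rw [h8, ← ENNReal.ofReal_mul (by norm_num),
      ← ENNReal.ofReal_inv_of_pos (mul_pos (by norm_num) (hpos i)), ← mul_div_assoc, inv_div]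
  · rw [ENNReal.tsum_mul_left]
    calc 8 * ∑' i, ENNReal.ofReal (A i / (M i : ℝ) ^ (σ + 1)) ≤ 8 * (ε / 8) := by gcongr
      _ = ε := ENNReal.mul_div_cancel (by simp) (by simp)

lemma TubeNull.capacity_eq_zero {n : ℕ} (hn : 2 ≤ n) {σ : ℝ} (hσ : 0 ≤ σ)
    {S : Set (EuclideanSpace ℂ (Fin n))} (hS : TubeNull (2 * n - 2) (σ + 1) S) :
    innerCapacity σ S = 0 ∧ outerCapacity σ S = 0 := by
  have key : ∀ ε : ℝ≥0∞, ε ≠ 0 → ε ≠ ∞ → ∃ G, IsOpen G ∧ S ⊆ G ∧ innerCapacity σ G ≤ ε := by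
    intro ε hε0 hε
    obtain ⟨G, hG, hSG, h⟩ := hS.exists_isOpen_le_energy hn hσ hε0 hε
    refine ⟨G, hG, hSG, iSup_le fun K => iSup_le fun _ => iSup_le fun hKG => ?_⟩
    rw [compactCapacity, ENNReal.inv_le_iff_inv_le]
    refine le_iInf fun μ => le_iInf fun hμ => le_iInf fun hK => ?_
    exact h μ (measure_mono_null (compl_subset_compl.2 hKG) hK)
  constructor
  · refine le_antisymm (le_of_forall_pos_le_add fun ε hε => ?_) zero_le
    rw [zero_add]
    by_cases hε' : ε = ∞
    · simp [hε']
    obtain ⟨G, -, hSG, h⟩ := key ε hε.ne' hε'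
    refine le_trans (iSup_le fun K => iSup_le fun hK => iSup_le fun hKS => ?_) h
    exact le_iSup_of_le K (le_iSup_of_le hK (le_iSup_of_le (hKS.trans hSG) le_rfl))
  · refine le_antisymm (le_of_forall_pos_le_add fun ε hε => ?_) zero_le
    rw [zero_add]
    by_cases hε' : ε = ∞
    · simp [hε']
    obtain ⟨G, hG, hSG, h⟩ := key ε hε.ne' hε'
    refine le_trans ?_ h
    unfold outerCapacity
    exact iInf_le_of_le G (iInf_le_of_le hG (iInf_le_of_le hSG le_rfl))

/-- Covers indexed by any countable type can be used to estimate the Hausdorff content: they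
are completed to sequences by empty balls of radius `0`. -/
lemma hausdorffContent_le_tsum {X : Type*} [PseudoMetricSpace X] [Nonempty X] {h : ℝ → ℝ}
    (h0 : h 0 = 0) {E : Set X} {ε : ℝ} (hε : 0 < ε) {ι : Type*} [Countable ι] (x : ι → X)
    (r : ι → ℝ) (hr : ∀ i, 0 ≤ r i ∧ r i < ε) (hE : E ⊆ ⋃ i, Metric.ball (x i) (r i)) :
    hausdorffContent h E ε ≤ ∑' i, ENNReal.ofReal (h (r i)) := by
  obtain ⟨e, he⟩ := exists_injective_nat ι
  obtain ⟨x0⟩ := ‹Nonempty X›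
  have hR : ∀ j, 0 ≤ Function.extend e r 0 j ∧ Function.extend e r 0 j < ε := by
    intro j
    by_cases hj : ∃ i, e i = j
    · obtain ⟨i, rfl⟩ := hj
      rw [he.extend_apply]; exact hr i
    · rw [Function.extend_apply' _ _ _ hj]; exact ⟨le_rfl, hε⟩
  have hcov : E ⊆ ⋃ j, Metric.ball (Function.extend e x (fun _ => x0) j)
      (Function.extend e r 0 j) := by
    refine hE.trans (iUnion_subset fun i => ?_)
    refine subset_iUnion_of_subset (e i) ?_
    rw [he.extend_apply, he.extend_apply]
  rw [← tsum_extend_zero he]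
  unfold hausdorffContent
  refine iInf_le_of_le _ (iInf_le_of_le _ (iInf_le_of_le hR (iInf_le_of_le hcov ?_)))
  refine le_of_eq (tsum_congr fun j => ?_)
  by_cases hj : ∃ i, e i = j
  · obtain ⟨i, rfl⟩ := hj
    rw [he.extend_apply, he.extend_apply]
  · rw [Function.extend_apply' _ _ _ hj, Function.extend_apply' _ _ _ hj]
    simp [h0]

/-- Covering tube `i` by `A i * exp (M i * (2 n - 2))` balls of radius `exp (-M i)` costs at most
`A i / (M i) ^ δ` in the gauge `h_δ`. -/
lemma TubeNull.hausdorffMeasure_eq_zero {n : ℕ} (hn : 2 ≤ n) {δ : ℝ}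
    {S : Set (EuclideanSpace ℂ (Fin n))} (hS : TubeNull (2 * n - 2) δ S) :
    hausdorffMeasure (gauge n δ) S = 0 := by
  classical
  refine le_antisymm (iSup_le fun ε => iSup_le fun hε => ?_) zero_le
  refine le_of_forall_pos_le_add fun η hη => ?_
  rw [zero_add]
  obtain ⟨m, hm⟩ : ∃ m : ℕ, Real.exp (-(m : ℝ)) < ε := by
    obtain ⟨m, hm⟩ := exists_nat_gt (-Real.log ε)
    exact ⟨m, by rw [← Real.lt_log_iff_exp_lt hε]; linarith⟩
  obtain ⟨ι, hι, T, A, M, hST, hT, hsum⟩ := hS η hη.ne' m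
  choose P hP hd hcard using fun i => (hT i).2.2.2 (M i) le_rfl (by omega)
  have hcen : ∀ Q : Set (EuclideanSpace ℂ (Fin n)), ∃ c, Q.Nonempty → c ∈ Q := fun Q => by
    by_cases hQ : Q.Nonempty
    · exact ⟨hQ.some, fun _ => hQ.some_mem⟩
    · exact ⟨0, fun h => absurd h hQ⟩
  choose c hc using hcen
  have h0 : gauge n δ 0 = 0 := by
    rw [gauge, zero_pow (by omega), zero_mul]
  refine (hausdorffContent_le_tsum h0 hε (ι := Σ i, {Q // Q ∈ P i}) (fun x => c x.2.1)
    (fun x => Real.exp (-(M x.1 : ℝ))) (fun x => ⟨(Real.exp_pos _).le, ?_⟩) ?_).trans ?_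
  · refine lt_of_le_of_lt (Real.exp_le_exp.2 ?_) hm
    have : (m : ℝ) ≤ M x.1 := by exact_mod_cast (hT x.1).2.2.1
    linarith
  · intro y hy
    obtain ⟨i, hi⟩ := mem_iUnion.1 (hST hy)
    obtain ⟨Q, hQ, hyQ⟩ := hP i hi
    exact mem_iUnion.2 ⟨⟨i, Q, by simpa using hQ⟩,
      hd i Q (by simpa using hQ) y hyQ _ (hc Q ⟨y, hyQ⟩)⟩
  · rw [ENNReal.tsum_sigma
      (fun i (_ : {Q // Q ∈ P i}) => ENNReal.ofReal (gauge n δ (Real.exp (-(M i : ℝ)))))]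
    refine (ENNReal.tsum_le_tsum fun i => ?_).trans hsum
    rw [tsum_fintype, Finset.sum_const, Finset.card_univ, Fintype.card_coe, nsmul_eq_mul,
      ← ENNReal.ofReal_natCast, ← ENNReal.ofReal_mul (by positivity)]
    apply ENNReal.ofReal_le_ofReal
    have hg : gauge n δ (Real.exp (-(M i : ℝ))) =
        (Real.exp (M i * (2 * n - 2 : ℕ)))⁻¹ * (M i : ℝ) ^ (-δ) := by
      rw [gauge, Real.log_exp, abs_neg, Nat.abs_cast, ← Real.exp_nat_mul, ← Real.exp_neg]
      congr 2; ring
    rw [hg, div_eq_mul_inv, ← Real.rpow_neg (by positivity), ← mul_assoc]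
    gcongr
    rw [← div_eq_mul_inv, div_le_iff₀ (Real.exp_pos _)]
    exact hcard i

/-! ### Covering numbers of neighbourhoods of graphs -/

lemma floor_mem_Icc_of_norm_le {x B s : ℝ} (hs : 0 < s) (hx : |x| ≤ B) :
    ⌊x / s⌋ ∈ Finset.Icc (-(⌈B / s⌉₊ : ℤ)) ⌈B / s⌉₊ := by
  have h1 : |x / s| ≤ (⌈B / s⌉₊ : ℝ) := by
    rw [abs_div, abs_of_pos hs]
    exact (div_le_div_of_nonneg_right hx hs.le).trans (Nat.le_ceil _)
  rw [abs_le] at h1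
  rw [Finset.mem_Icc]
  constructor
  · rw [Int.le_floor]; push_cast; exact h1.1
  · have := (Int.floor_le (x / s)).trans h1.2
    exact_mod_cast this

lemma norm_sub_le_of_floor_eq {w w' : ℂ} {r : ℝ} (hr : 0 < r)
    (hre : ⌊w.re / (r / 2)⌋ = ⌊w'.re / (r / 2)⌋) (him : ⌊w.im / (r / 2)⌋ = ⌊w'.im / (r / 2)⌋) :
    ‖w - w'‖ ≤ r := by
  have key : ∀ a b : ℝ, ⌊a / (r / 2)⌋ = ⌊b / (r / 2)⌋ → |a - b| ≤ r / 2 := by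
    intro a b h
    have h1 := Int.abs_sub_lt_one_of_floor_eq_floor h
    rw [← sub_div, abs_div, abs_of_pos (half_pos hr), div_lt_one (half_pos hr)] at h1
    exact h1.le
  have h := Complex.norm_le_abs_re_add_abs_im (w - w')
  have h1 := key _ _ hre
  have h2 := key _ _ him
  simp only [Complex.sub_re, Complex.sub_im] at h
  linarith

/-- Let `W` be bounded complex coordinates on `T` with Lipschitz inverse. If `W l` is determined,
up to an error comparable to any scale above `r₀`, by the other coordinates and by a parameter `q`
with finitely many values, then `T` has real dimension `2 n - 2` down to a scale comparable
to `r₀`, and its volume is at most proportional to the number of values of `q`. -/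
lemma scaleCover_of_coordinates {X : Type*} [PseudoMetricSpace X] {n : ℕ} {T : Set X}
    (W : X → Fin n → ℂ) (l : Fin n) (q : X → ℤ) (Z : Finset ℤ) {B Λ C r₀ : ℝ} {M : ℕ}
    (hB0 : 0 ≤ B) (hΛ1 : 1 ≤ Λ) (hC1 : 1 ≤ C)
    (hB : ∀ x ∈ T, ∀ j, ‖W x j‖ ≤ B) (hq : ∀ x ∈ T, q x ∈ Z)
    (hΛ : ∀ x ∈ T, ∀ y ∈ T, ∀ r, 0 ≤ r → (∀ j, ‖W x j - W y j‖ ≤ r) → dist x y ≤ Λ * r)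
    (hdet : ∀ x ∈ T, ∀ y ∈ T, q x = q y → ∀ r, r₀ ≤ r → (∀ j ≠ l, ‖W x j - W y j‖ ≤ r) →
      ‖W x l - W y l‖ ≤ C * r)
    (hr₀ : r₀ ≤ Real.exp (-(2 * M)) / (2 * Λ * C)) :
    ScaleCover (2 * n - 2) (Z.card * (8 * Λ * C * B + 3) ^ (2 * n - 2)) M T := by
  classical
  intro t _ ht
  set r : ℝ := Real.exp (-t) / (2 * Λ * C) with hr
  have hΛ0 : 0 < Λ := by linarith
  have hC0 : 0 < C := by linarith
  have hr0 : 0 < r := by positivity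
  have hrr : r₀ ≤ r := by
    refine hr₀.trans ?_
    have : (t : ℝ) ≤ 2 * M := by exact_mod_cast ht
    rw [hr]; gcongr
  -- colour a point by `q` and by the cells of a grid of mesh `r / 2` that contain the real and
  -- imaginary parts of the coordinates other than `W l`
  set a : ℕ := ⌈B / (r / 2)⌉₊ with ha
  set I : Finset ℤ := Finset.Icc (-(a : ℤ)) a with hI
  let f : X → ℤ × ({j // j ≠ l} → ℤ × ℤ) := fun x =>
    (q x, fun j => (⌊(W x j).re / (r / 2)⌋, ⌊(W x j).im / (r / 2)⌋))
  let S : Finset (ℤ × ({j // j ≠ l} → ℤ × ℤ)) := Z ×ˢ Fintype.piFinset fun _ => I ×ˢ I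
  have hfS : ∀ x ∈ T, f x ∈ S := by
    intro x hx
    simp only [S, f, Finset.mem_product, Fintype.mem_piFinset]
    refine ⟨hq x hx, fun j => ⟨?_, ?_⟩⟩
    · exact floor_mem_Icc_of_norm_le (half_pos hr0) ((Complex.abs_re_le_norm _).trans (hB x hx j))
    · exact floor_mem_Icc_of_norm_le (half_pos hr0) ((Complex.abs_im_le_norm _).trans (hB x hx j))
  refine ⟨S.image fun c => T ∩ f ⁻¹' {c}, ?_, ?_, ?_⟩
  · intro x hx
    exact ⟨T ∩ f ⁻¹' {f x}, by simpa using ⟨_, _, hfS x hx, rfl⟩, hx, rfl⟩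
  · intro Q hQ x hx y hy
    obtain ⟨c, -, rfl⟩ := Finset.mem_image.1 hQ
    have hxy : f x = f y := hx.2.trans hy.2.symm
    have hqxy : q x = q y := congrArg Prod.fst hxy
    have hne : ∀ j ≠ l, ‖W x j - W y j‖ ≤ r := by
      intro j hj
      have h := congrFun (congrArg Prod.snd hxy) ⟨j, hj⟩
      exact norm_sub_le_of_floor_eq hr0 (congrArg Prod.fst h) (congrArg Prod.snd h)
    have hall : ∀ j, ‖W x j - W y j‖ ≤ C * r := by
      intro j
      by_cases hj : j = l
      · subst hj; exact hdet x hx.1 y hy.1 hqxy r hrr hne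
      · exact (hne j hj).trans (le_mul_of_one_le_left hr0.le hC1)
    have h := hΛ x hx.1 y hy.1 (C * r) (by positivity) hall
    have h2 : Λ * (C * r) = Real.exp (-t) / 2 := by rw [hr]; field_simp
    rw [h2] at h
    have := Real.exp_pos (-(t : ℝ))
    linarith
  · have hcardI : (I.card : ℝ) = 2 * a + 1 := by
      rw [hI, Int.card_Icc]
      have : ((a : ℤ) + 1 - -(a : ℤ)).toNat = 2 * a + 1 := by omega
      rw [this]; push_cast; ring
    have hIle : (I.card : ℝ) ≤ (8 * Λ * C * B + 3) * Real.exp t := by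
      have h1 : (a : ℝ) ≤ B / (r / 2) + 1 := (Nat.ceil_lt_add_one (by positivity)).le
      have h2 : B / (r / 2) = 4 * Λ * C * B * Real.exp t := by
        rw [hr, Real.exp_neg]; field_simp; norm_num
      have h3 : 1 ≤ Real.exp t := Real.one_le_exp (by positivity)
      rw [hcardI]
      nlinarith
    have hcardS : S.card = Z.card * I.card ^ (2 * n - 2) := by
      simp only [S, Finset.card_product, Fintype.card_piFinset, Finset.prod_const,
        Finset.card_univ]
      have : Fintype.card {j // j ≠ l} = n - 1 := by simp
      rw [this, ← sq, ← pow_mul]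
      congr 2; omega
    calc ((S.image fun c => T ∩ f ⁻¹' {c}).card : ℝ) ≤ S.card := by
          exact_mod_cast Finset.card_image_le
      _ = Z.card * (I.card : ℝ) ^ (2 * n - 2) := by rw [hcardS]; push_cast; rfl
      _ ≤ Z.card * ((8 * Λ * C * B + 3) * Real.exp t) ^ (2 * n - 2) := by gcongr
      _ = _ := by rw [mul_pow, ← Real.exp_nat_mul]; ring_nf

lemma dist_le_mul_of_forall_norm_sub_le {n : ℕ} {x y : EuclideanSpace ℂ (Fin n)} {r : ℝ}
    (hr : 0 ≤ r) (h : ∀ j, ‖x j - y j‖ ≤ r) : dist x y ≤ n * r := by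
  rw [EuclideanSpace.dist_eq]
  apply Real.sqrt_le_iff.2 ⟨by positivity, ?_⟩
  calc ∑ i, dist (x i) (y i) ^ 2 ≤ ∑ i : Fin n, r ^ 2 := by
        gcongr with i; rw [dist_eq_norm]; exact h i
    _ = n * r ^ 2 := by simp
    _ ≤ (n * r) ^ 2 := by
        rw [mul_pow]; gcongr
        rcases Nat.eq_zero_or_pos n with rfl | hn
        · simp
        · have : (1 : ℝ) ≤ n := by exact_mod_cast hn
          nlinarith

lemma scaleCover_coordinate_hyperplane {n : ℕ} (i : Fin n) {R ρ : ℝ} (hR : 0 ≤ R) {M : ℕ}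
    (hρ : ρ ≤ Real.exp (-(2 * M)) / (4 * n)) :
    ScaleCover (2 * n - 2) ((8 * n * R + 3) ^ (2 * n - 2)) M
      {lam : EuclideanSpace ℂ (Fin n) | ‖lam i‖ < ρ ∧ ∀ j, ‖lam j‖ < R} := by
  have hn : (1 : ℝ) ≤ n := by exact_mod_cast Fin.pos i
  have h := scaleCover_of_coordinates
    (T := {lam : EuclideanSpace ℂ (Fin n) | ‖lam i‖ < ρ ∧ ∀ j, ‖lam j‖ < R})
    (fun x j => x j) i (fun _ => 0) {0} (C := 1) (Λ := n) (r₀ := 2 * ρ) (M := M) hR hn le_rfl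
    (fun x hx j => (hx.2 j).le) (fun _ _ => by simp)
    (fun x _ y _ r hr hxy => dist_le_mul_of_forall_norm_sub_le hr hxy)
    (fun x hx y hy _ r hr _ => by
      have := norm_sub_le (x i) (y i)
      have := hx.1
      have := hy.1
      linarith)
    (by
      have h2 : Real.exp (-(2 * M)) / (2 * n * 1) = 2 * (Real.exp (-(2 * M)) / (4 * n)) := by
        field_simp; norm_num
      rw [h2]; linarith)
  simpa using h

/-! ### Neighbourhoods of resonances in logarithmic coordinates -/

/-- The exponential is `R`-Lipschitz on the half-plane `{w | |exp w| ≤ R}`, which is convex. -/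
lemma norm_exp_sub_exp_le {a b : ℂ} {R : ℝ} (ha : ‖Complex.exp a‖ ≤ R)
    (hb : ‖Complex.exp b‖ ≤ R) : ‖Complex.exp a - Complex.exp b‖ ≤ R * ‖a - b‖ := by
  have hR : 0 < R := (norm_pos_iff.2 (Complex.exp_ne_zero a)).trans_le ha
  have hmem : ∀ w : ℂ, ‖Complex.exp w‖ ≤ R ↔ w ∈ {w : ℂ | w.re ≤ Real.log R} := fun w => by
    rw [Complex.norm_exp, mem_ofPred_eq, Real.le_log_iff_exp_le hR]
  refine Convex.norm_image_sub_le_of_norm_deriv_le (s := {w : ℂ | w.re ≤ Real.log R})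
    (fun w _ => Complex.differentiableAt_exp) (fun w hw => ?_)
    (convex_halfSpace_re_le _) ((hmem b).1 hb) ((hmem a).1 ha)
  rw [Complex.deriv_exp]; exact (hmem w).2 hw

lemma exists_int_norm_sub_le {u : ℂ} {ε : ℝ} (h : ‖Complex.exp u - 1‖ ≤ ε) (hε : ε ≤ 1 / 2) :
    ∃ q : ℤ, ‖u - q * (2 * Real.pi * Complex.I)‖ ≤ 2 * ε := by
  have h1 := Complex.norm_log_one_add_half_le_self (z := Complex.exp u - 1) (h.trans hε)
  rw [add_sub_cancel] at h1
  have h2 : Complex.exp u = Complex.exp (Complex.log (Complex.exp u)) :=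
    (Complex.exp_log (Complex.exp_ne_zero u)).symm
  obtain ⟨q, hq⟩ := Complex.exp_eq_exp_iff_exists_int.1 h2
  refine ⟨q, ?_⟩
  have h3 : u - q * (2 * Real.pi * Complex.I) = Complex.log (Complex.exp u) := by
    linear_combination hq
  rw [h3]
  have := norm_nonneg (Complex.exp u - 1)
  linarith

lemma norm_log_le_of_norm_mem {z : ℂ} {R : ℝ} (hR : 1 ≤ R) (h1 : 1 / R < ‖z‖) (h2 : ‖z‖ < R) :
    ‖Complex.log z‖ ≤ Real.log R + Real.pi := by
  have hz : 0 < ‖z‖ := lt_trans (by positivity) h1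
  refine (Complex.norm_le_abs_re_add_abs_im _).trans (add_le_add ?_ ?_)
  · rw [Complex.log_re, abs_le]
    constructor
    · rw [← Real.log_inv]
      exact Real.log_le_log (by positivity) (by simpa using h1.le)
    · exact Real.log_le_log hz h2.le
  · rw [Complex.log_im]; exact Complex.abs_arg_le_pi _

/-- In logarithmic coordinates `w = log λ`, the set `|λ^k - λ_i| < ρ` is contained in a
neighbourhood of the union of the hyperplanes `∑ K_j w_j ∈ 2 π i q`, with `K = k - e_i` and with at
most `O(|k|)` integers `q`. Solving for the coordinate with the largest `|K_l|` exhibits each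
hyperplane as the graph of a function with Lipschitz constant at most `n`. -/
lemma exists_scaleCover_resonance (n : ℕ) {R : ℝ} (hR : 1 ≤ R) :
    ∃ c₁ > 0, ∃ c₂ > 0, ∀ (k : Fin n → ℕ) (i : Fin n) (M : ℕ) (ρ : ℝ), 2 ≤ ∑ j, k j → 0 ≤ ρ →
      ρ ≤ c₁ * Real.exp (-(2 * M)) →
      ScaleCover (2 * n - 2) (c₂ * ((∑ j, k j : ℕ) + 1)) M
        {lam : EuclideanSpace ℂ (Fin n) | (∀ j, 1 / R < ‖lam j‖ ∧ ‖lam j‖ < R) ∧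
          ‖(∏ j, lam j ^ k j) - lam i‖ < ρ} := by
  set B : ℝ := Real.log R + Real.pi with hB
  have hR0 : 0 < R := by linarith
  have hB0 : 0 < B := add_pos_of_nonneg_of_pos (Real.log_nonneg hR) Real.pi_pos
  rcases Nat.eq_zero_or_pos n with rfl | hn
  · exact ⟨1, one_pos, 1, one_pos, fun k i => i.elim0⟩
  have hn1 : (1 : ℝ) ≤ n := by exact_mod_cast hn
  have hΛ1 : 1 ≤ n * R := by nlinarith
  refine ⟨1 / (8 * R * (n * R) * (n + 1)), by positivity,
    (2 * B + 5) * (8 * (n * R) * (n + 1) * B + 3) ^ (2 * n - 2), by positivity, ?_⟩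
  intro k i M ρ hk hρ0 hρ
  set T := {lam : EuclideanSpace ℂ (Fin n) | (∀ j, 1 / R < ‖lam j‖ ∧ ‖lam j‖ < R) ∧
          ‖(∏ j, lam j ^ k j) - lam i‖ < ρ} with hT
  have hρR : R * ρ ≤ 1 / 2 := by
    have h1 : Real.exp (-(2 * M)) ≤ 1 := Real.exp_le_one_iff.2 (by simp)
    have h2 : ρ ≤ 1 / (8 * R * (n * R) * (n + 1)) :=
      hρ.trans (mul_le_of_le_one_right (by positivity) h1)
    rw [le_div_iff₀ (by positivity)] at h2
    have h3 : 8 * (R * ρ) * 1 ≤ 8 * (R * ρ) * ((n * R) * (n + 1)) := by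
      gcongr
      nlinarith
    nlinarith
  let K : Fin n → ℤ := fun j => k j - if j = i then 1 else 0
  obtain ⟨l, -, hl⟩ := Finset.exists_max_image Finset.univ (fun j => |K j|) ⟨i, Finset.mem_univ i⟩
  -- `K` is nonzero because its entries add up to `|k| - 1 ≥ 1`
  have hKl : (1 : ℝ) ≤ |(K l : ℝ)| := by
    have h0 : K l ≠ 0 := by
      intro h0
      have hz : ∀ j, K j = 0 := fun j => by
        have := hl j (Finset.mem_univ j)
        rw [h0, abs_zero] at this
        exact abs_nonpos_iff.1 this
      have hsum : ∑ j, K j = (∑ j, k j : ℕ) - 1 := by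
        simp [K, Finset.sum_sub_distrib]
      rw [Finset.sum_eq_zero fun j _ => hz j] at hsum
      omega
    exact_mod_cast Int.one_le_abs h0
  let W : EuclideanSpace ℂ (Fin n) → Fin n → ℂ := fun x j => Complex.log (x j)
  let u : EuclideanSpace ℂ (Fin n) → ℂ := fun x => ∑ j, (K j : ℂ) * W x j
  have hne : ∀ x ∈ T, ∀ j, x j ≠ 0 := fun x hx j =>
    norm_pos_iff.1 (lt_trans (by positivity) (hx.1 j).1)
  have hexpW : ∀ x ∈ T, ∀ j, Complex.exp (W x j) = x j := fun x hx j =>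
    Complex.exp_log (hne x hx j)
  have hu' : ∀ x, u x = ∑ j, (k j : ℂ) * W x j - W x i := by
    intro x
    simp [u, K, sub_mul, Finset.sum_sub_distrib]
  have hexpu : ∀ x ∈ T, Complex.exp (u x) = (∏ j, x j ^ k j) / x i := by
    intro x hx
    rw [hu', Complex.exp_sub, Complex.exp_sum, hexpW x hx]
    congr 1
    refine Finset.prod_congr rfl fun j _ => ?_
    rw [Complex.exp_nat_mul, hexpW x hx]
  have hclose : ∀ x ∈ T, ‖Complex.exp (u x) - 1‖ ≤ R * ρ := by
    intro x hx
    have hxi := hne x hx i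
    have : (∏ j, x j ^ k j) / x i - 1 = ((∏ j, x j ^ k j) - x i) * (x i)⁻¹ := by
      field_simp
    rw [hexpu x hx, this, norm_mul, mul_comm, norm_inv]
    gcongr
    · rw [inv_le_comm₀ (norm_pos_iff.2 hxi) hR0, ← one_div]; exact (hx.1 i).1.le
    · exact hx.2.le
  have hWB : ∀ x ∈ T, ∀ j, ‖W x j‖ ≤ B := fun x hx j =>
    norm_log_le_of_norm_mem hR (hx.1 j).1 (hx.1 j).2
  choose! q hq using fun x (hx : x ∈ T) => exists_int_norm_sub_le (hclose x hx) hρR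
  set m : ℝ := ((∑ j, k j : ℕ) : ℝ) + 1 with hm
  have hm1 : 1 ≤ m := by rw [hm]; linarith [Nat.cast_nonneg (α := ℝ) (∑ j, k j)]
  have hqle : ∀ x ∈ T, |(q x : ℝ)| ≤ m * (B + 1) := by
    intro x hx
    have h1 : ‖u x‖ ≤ m * B := by
      rw [hu']
      refine (norm_sub_le _ _).trans ?_
      rw [hm, add_mul, one_mul]
      gcongr
      · refine (norm_sum_le _ _).trans ?_
        rw [Nat.cast_sum, Finset.sum_mul]
        gcongr with j
        rw [norm_mul, Complex.norm_natCast]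
        gcongr
        exact hWB x hx j
      · exact hWB x hx i
    have h2 : ‖(q x : ℂ) * (2 * Real.pi * Complex.I)‖ = |(q x : ℝ)| * (2 * Real.pi) := by
      rw [norm_mul, norm_mul, norm_mul, Complex.norm_I, Complex.norm_real, Complex.norm_intCast,
        Real.norm_of_nonneg Real.pi_pos.le]
      simp
    have h3 : |(q x : ℝ)| * (2 * Real.pi) ≤ m * B + 1 := by
      rw [← h2]
      have h4 := norm_sub_norm_le ((q x : ℂ) * (2 * Real.pi * Complex.I)) (u x)
      rw [norm_sub_rev] at h4
      have h5 := hq x hx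
      linarith
    have h4 : 1 ≤ 2 * Real.pi := by linarith [Real.pi_gt_three]
    have h5 : |(q x : ℝ)| ≤ |(q x : ℝ)| * (2 * Real.pi) := le_mul_of_one_le_right (abs_nonneg _) h4
    linarith
  set b : ℕ := ⌈m * (B + 1)⌉₊ with hb
  have hcover := scaleCover_of_coordinates (T := T) W l q (Finset.Icc (-(b : ℤ)) b) (B := B)
    (Λ := n * R) (C := n + 1) (r₀ := 4 * (R * ρ)) (M := M) hB0.le hΛ1 (by linarith) hWB
    (fun x hx => by
      have := floor_mem_Icc_of_norm_le one_pos (hqle x hx)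
      simpa [hb] using this)
    (fun x hx y hy r hr hxy => by
      rw [mul_assoc]
      refine dist_le_mul_of_forall_norm_sub_le (by positivity) fun j => ?_
      rw [← hexpW x hx, ← hexpW y hy]
      refine (norm_exp_sub_exp_le (R := R) ?_ ?_).trans (by gcongr; exact hxy j)
      · rw [hexpW x hx]; exact (hx.1 j).2.le
      · rw [hexpW y hy]; exact (hy.1 j).2.le)
    (fun x hx y hy hxy r hr hr' => by
      -- solving `∑ K_j w_j = 2 π i q + O(R ρ)` for the coordinate `w_l`
      have hsplit : (K l : ℂ) * (W x l - W y l) =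
          (u x - q x * (2 * Real.pi * Complex.I)) - (u y - q y * (2 * Real.pi * Complex.I))
          - ∑ j ∈ Finset.univ.erase l, (K j : ℂ) * (W x j - W y j) := by
        have h1 : u x - u y = ∑ j, (K j : ℂ) * (W x j - W y j) := by
          simp only [u, ← Finset.sum_sub_distrib, mul_sub]
        rw [← Finset.add_sum_erase _ _ (Finset.mem_univ l)] at h1
        rw [hxy]
        linear_combination -h1
      have hsum : ‖∑ j ∈ Finset.univ.erase l, (K j : ℂ) * (W x j - W y j)‖ ≤
          n * (|(K l : ℝ)| * r) := by
        have hr0 : 0 ≤ r := le_trans (by positivity) hr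
        refine (norm_sum_le _ _).trans ?_
        refine (Finset.sum_le_card_nsmul _ _ (|(K l : ℝ)| * r) fun j hj => ?_).trans ?_
        · rw [norm_mul, Complex.norm_intCast]
          exact mul_le_mul (by exact_mod_cast hl j (Finset.mem_univ j))
            (hr' j (Finset.ne_of_mem_erase hj)) (norm_nonneg _) (abs_nonneg _)
        · rw [nsmul_eq_mul]
          gcongr
          exact (Finset.card_le_univ _).trans (by simp)
      have hmul : |(K l : ℝ)| * ‖W x l - W y l‖ ≤ |(K l : ℝ)| * ((n + 1) * r) := by
        have hr0 : 0 ≤ r := le_trans (by positivity) hr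
        rw [← Complex.norm_intCast, ← norm_mul, hsplit, Complex.norm_intCast]
        have e1 := norm_sub_le ((u x - q x * (2 * Real.pi * Complex.I)) -
          (u y - q y * (2 * Real.pi * Complex.I)))
          (∑ j ∈ Finset.univ.erase l, (K j : ℂ) * (W x j - W y j))
        have e2 := norm_sub_le (u x - q x * (2 * Real.pi * Complex.I))
          (u y - q y * (2 * Real.pi * Complex.I))
        have e3 := hq x hx
        have e4 := hq y hy
        have e5 : r ≤ |(K l : ℝ)| * r := le_mul_of_one_le_left hr0 hKl
        linarith
      exact le_of_mul_le_mul_left hmul (by linarith))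
    (by
      calc 4 * (R * ρ) ≤
            4 * (R * (1 / (8 * R * (n * R) * (n + 1)) * Real.exp (-(2 * M)))) := by gcongr
        _ = _ := by field_simp; norm_num)
  intro t ht ht'
  obtain ⟨P, hP, hd, hcard⟩ := hcover t ht ht'
  refine ⟨P, hP, hd, hcard.trans ?_⟩
  have hbcard : ((Finset.Icc (-(b : ℤ)) b).card : ℝ) ≤ (2 * B + 5) * m := by
    have h1 : ((b : ℤ) + 1 - -(b : ℤ)).toNat = 2 * b + 1 := by omega
    rw [Int.card_Icc, h1]
    have h2 : (b : ℝ) ≤ m * (B + 1) + 1 := (Nat.ceil_lt_add_one (by positivity)).le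
    push_cast
    nlinarith
  rw [mul_right_comm _ _ m]
  gcongr

/-! ### The exceptional set of the Brjuno condition -/

lemma summable_prod_of_summable {f : ℕ → ℝ} (hf0 : ∀ m, 0 ≤ f m) (hf : Summable f) (n : ℕ) :
    Summable fun k : Fin n → ℕ => ∏ j, f (k j) := by
  induction n with
  | zero => exact Summable.of_finite
  | succ n ih =>
    have h := hf.mul_of_nonneg ih hf0 (fun k => Finset.prod_nonneg fun j _ => hf0 (k j))
    rw [← (Fin.consEquiv fun _ : Fin (n + 1) => ℕ).summable_iff]
    refine h.congr fun x => ?_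
    simp [Fin.prod_univ_succ, Fin.consEquiv]

/-- The bound `(|k| + 1) ^ n ≥ ∏ (k j + 1)` reduces the claim to a product of one-variable
series. -/
lemma summable_sum_add_one_rpow_neg {n : ℕ} {s : ℝ} (hs : (n : ℝ) < s) :
    Summable fun k : Fin n → ℕ => (((∑ j, k j : ℕ) : ℝ) + 1) ^ (-s) := by
  rcases Nat.eq_zero_or_pos n with rfl | hn
  · exact Summable.of_finite
  have hn0 : (0 : ℝ) < n := by exact_mod_cast hn
  have hf : Summable fun m : ℕ => ((m : ℝ) + 1) ^ (-(s / n)) := by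
    have h := (summable_nat_add_iff 1).2
      (Real.summable_nat_rpow (p := -(s / n)) |>.2
        (by rw [neg_lt_neg_iff, one_lt_div hn0]; exact hs))
    simpa using h
  refine Summable.of_nonneg_of_le (fun k => by positivity) (fun k => ?_)
    (summable_prod_of_summable (fun m => by positivity) hf n)
  calc (((∑ j, k j : ℕ) : ℝ) + 1) ^ (-s)
      = ∏ _j : Fin n, (((∑ j, k j : ℕ) : ℝ) + 1) ^ (-(s / n)) := by
        rw [Finset.prod_const, Finset.card_univ, Fintype.card_fin, ← Real.rpow_mul_natCast
          (by positivity)]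
        congr 1; field_simp
    _ ≤ ∏ j, ((k j : ℝ) + 1) ^ (-(s / n)) := by
        refine Finset.prod_le_prod (fun j _ => by positivity) fun j _ => ?_
        refine Real.rpow_le_rpow_of_nonpos (by positivity) ?_
          (neg_nonpos.2 (div_nonneg (hn0.trans hs).le hn0.le))
        gcongr
        exact Finset.single_le_sum (fun _ _ => Nat.zero_le _) (Finset.mem_univ j)

/-- Small divisors bounded below by `exp (-O(|k| ^ β))` with `β < 1` imply the Brjuno
condition. -/
lemma brjuno_of_exp_neg_le {n : ℕ} (hn : 1 ≤ n) {β : ℝ} (hβ0 : 0 ≤ β) (hβ : β < 1) (L : ℕ)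
    {lam : EuclideanSpace ℂ (Fin n)}
    (h : ∀ (k : Fin n → ℕ) (i : Fin n), 2 ≤ ∑ j, k j →
      Real.exp (-(3 * (⌈(((∑ j, k j : ℕ) : ℝ) + 1) ^ β⌉₊ + L : ℕ))) ≤
        ‖(∏ j, lam j ^ k j) - lam i‖) :
    Brjuno lam := by
  set g : ℕ → ℝ := fun m => 3 * ((⌈((m : ℝ) + 1) ^ β⌉₊ + L : ℕ) : ℝ) with hg
  have hgmono : Monotone g := by
    intro a b hab
    simp only [hg]
    gcongr
  have hpow : ∀ j : ℕ, 2 ≤ 2 ^ (j + 1) := fun j => by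
    rw [pow_succ]; have := Nat.one_le_two_pow (n := j); omega
  have hOm : ∀ m, 2 ≤ m → Real.exp (-g m) ≤ Omega lam m := by
    intro m hm
    obtain ⟨k, i, hk2, hkm, hx⟩ := (isLeast_Omega hn lam hm).1
    rw [hx]
    refine le_trans (Real.exp_le_exp.2 (neg_le_neg ?_)) (h k i hk2)
    exact hgmono hkm
  have hpos : ∀ m, 2 ≤ m → 0 < Omega lam m := fun m hm => (Real.exp_pos _).trans_le (hOm m hm)
  refine ⟨fun j hj => ?_, ?_⟩
  · obtain ⟨j, rfl⟩ := Nat.exists_eq_add_of_le' hj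
    exact (hpos _ (hpow j)).ne'
  set D : ℝ := 3 * (3 + L) + |Real.log (Omega lam 2)| with hD
  have hgle : ∀ j : ℕ, g (2 ^ (j + 1)) ≤ 12 * ((2 : ℝ) ^ β) ^ j + 3 * (3 + L) := by
    intro j
    have h1 : ((2 : ℝ) ^ (j + 1) + 1) ^ β ≤ 4 * ((2 : ℝ) ^ β) ^ j :=
      calc ((2 : ℝ) ^ (j + 1) + 1) ^ β ≤ (4 * (2 : ℝ) ^ j) ^ β := by
            gcongr
            have : (1 : ℝ) ≤ 2 ^ j := one_le_pow₀ (by norm_num)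
            rw [pow_succ]; linarith
        _ = 4 ^ β * ((2 : ℝ) ^ β) ^ j := by
            rw [Real.mul_rpow (by norm_num) (by positivity), Real.rpow_pow_comm (by norm_num)]
        _ ≤ 4 * ((2 : ℝ) ^ β) ^ j := by
            gcongr
            calc (4 : ℝ) ^ β ≤ 4 ^ (1 : ℝ) := by gcongr; norm_num
              _ = 4 := Real.rpow_one 4
    have h2 : (⌈(((2 ^ (j + 1) : ℕ) : ℝ) + 1) ^ β⌉₊ : ℝ) ≤ ((2 : ℝ) ^ (j + 1) + 1) ^ β + 1 := by
      push_cast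
      exact (Nat.ceil_lt_add_one (by positivity)).le
    simp only [hg]
    push_cast at h2 ⊢
    linarith
  have hterm : ∀ j : ℕ, ‖(1 / 2 ^ (j + 1) : ℝ) * Real.log (1 / Omega lam (2 ^ (j + 1)))‖ ≤
      6 * ((2 : ℝ) ^ β / 2) ^ j + D * (1 / 2) ^ j := by
    intro j
    have hup : Real.log (1 / Omega lam (2 ^ (j + 1))) ≤ g (2 ^ (j + 1)) := by
      rw [one_div, Real.log_inv]
      have := Real.log_le_log (Real.exp_pos _) (hOm _ (hpow j))
      rw [Real.log_exp] at this
      linarith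
    -- `Ω(λ, ·)` is nonincreasing, which bounds the logarithms from below
    have hlow : -|Real.log (Omega lam 2)| ≤ Real.log (1 / Omega lam (2 ^ (j + 1))) := by
      have h1 : Omega lam (2 ^ (j + 1)) ≤ Omega lam 2 := by
        obtain ⟨k, i, hk2, hkm, hx⟩ := (isLeast_Omega hn lam le_rfl).1
        exact (isLeast_Omega hn lam (hpow j)).2 ⟨k, i, hk2, hkm.trans (hpow j), hx⟩
      rw [one_div, Real.log_inv]
      have := Real.log_le_log (hpos _ (hpow j)) h1
      have := le_abs_self (Real.log (Omega lam 2))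
      linarith
    have habs : |Real.log (1 / Omega lam (2 ^ (j + 1)))| ≤ 12 * ((2 : ℝ) ^ β) ^ j + D := by
      have h1 := hgle j
      have h2 : (0 : ℝ) ≤ 12 * ((2 : ℝ) ^ β) ^ j + 3 * (3 + L) := by positivity
      have h3 := abs_nonneg (Real.log (Omega lam 2))
      rw [abs_le]
      constructor <;> linarith
    have hD0 : 0 ≤ D := by positivity
    rw [norm_mul, Real.norm_eq_abs, Real.norm_eq_abs, abs_of_pos (by positivity)]
    calc 1 / 2 ^ (j + 1) * |Real.log (1 / Omega lam (2 ^ (j + 1)))|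
        ≤ 1 / 2 ^ (j + 1) * (12 * ((2 : ℝ) ^ β) ^ j + D) := by gcongr
      _ = 6 * ((2 : ℝ) ^ β / 2) ^ j + D / 2 * (1 / 2) ^ j := by
        rw [div_pow, div_pow, one_pow, pow_succ]; field_simp; ring
      _ ≤ _ := by gcongr; linarith
  refine Summable.of_norm_bounded (Summable.add ?_ ?_) hterm
  · refine (summable_geometric_of_lt_one (by positivity) ?_).mul_left 6
    rw [div_lt_one (by norm_num)]
    calc (2 : ℝ) ^ β < 2 ^ (1 : ℝ) := Real.rpow_lt_rpow_of_exponent_lt (by norm_num) hβ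
      _ = 2 := Real.rpow_one 2
  · exact summable_geometric_two.mul_left D

lemma tubeNull_coordinate_hyperplane {n : ℕ} (i : Fin n) {R : ℝ} (hR : 0 ≤ R) {p : ℝ}
    (hp : 0 < p) : TubeNull (2 * n - 2) p
      {lam : EuclideanSpace ℂ (Fin n) | lam i = 0 ∧ ∀ j, ‖lam j‖ < R} := by
  intro ε hε m
  have hn : (0 : ℝ) < n := by exact_mod_cast Fin.pos i
  set A : ℝ := (8 * n * R + 3) ^ (2 * n - 2) with hA
  have hlim : Filter.Tendsto (fun M : ℕ => ENNReal.ofReal (A / (M : ℝ) ^ p)) Filter.atTop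
      (nhds 0) := by
    rw [← ENNReal.ofReal_zero]
    exact ENNReal.tendsto_ofReal
      (((tendsto_rpow_atTop hp).comp tendsto_natCast_atTop_atTop).const_div_atTop A)
  obtain ⟨M, hMε, hMm⟩ :=
    ((hlim.eventually_le_const (pos_iff_ne_zero.2 hε)).and (Filter.eventually_ge_atTop m)).exists
  have hρ : 0 < Real.exp (-(2 * M)) / (4 * n) := by positivity
  refine ⟨Unit, inferInstance, fun _ => {lam | ‖lam i‖ < Real.exp (-(2 * M)) / (4 * n) ∧
    ∀ j, ‖lam j‖ < R}, fun _ => A, fun _ => M, ?_, fun _ => ⟨?_, by positivity, hMm,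
    scaleCover_coordinate_hyperplane i hR le_rfl⟩, by simpa using hMε⟩
  · intro x hx
    exact mem_iUnion.2 ⟨(), by simpa [hx.1] using hρ, hx.2⟩
  · simp only [ofPred_and, ofPred_forall]
    exact (isOpen_lt (by fun_prop) continuous_const).inter
      (isOpen_iInter_of_finite fun j => isOpen_lt (by fun_prop) continuous_const)

/-- The non-Brjuno points of the region `1 / R < |λ_j| < R` lie, for some `β < 1` and all `L`, in
the union of the sets `|λ^k - λ_i| < exp (-3 M)` with `M ≥ |k| ^ β + L`. The volumes are `O(|k|)`, and
`∑ |k| / M ^ p` is small for large `L`, since `β` can be chosen with `β p > n + 1`. -/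
lemma tubeNull_not_brjuno_of_annulus {n : ℕ} (hn : 1 ≤ n) {R : ℝ} (hR : 1 ≤ R) {p : ℝ}
    (hp : (n : ℝ) + 1 < p) : TubeNull (2 * n - 2) p
      {lam : EuclideanSpace ℂ (Fin n) | ¬ Brjuno lam ∧ ∀ j, 1 / R < ‖lam j‖ ∧ ‖lam j‖ < R} := by
  intro ε hε m
  obtain ⟨c₁, hc₁, c₂, hc₂, hcov⟩ := exists_scaleCover_resonance n hR
  have hn0 : (0 : ℝ) ≤ n := Nat.cast_nonneg n
  -- write `p = p₁ + (p - p₁)`: in `M ^ p ≥ |k| ^ (β p₁) * L ^ (p - p₁)` the first factor makes the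
  -- sum over `k` converge, and the second makes it small
  obtain ⟨p₁, hp₁, hp₁p⟩ := exists_between hp
  have hp₁0 : 0 < p₁ := by linarith
  obtain ⟨β, hβ, hβ1⟩ := exists_between ((div_lt_one hp₁0).2 hp₁)
  have hβ0 : 0 ≤ β := (div_nonneg (by linarith) hp₁0.le).trans hβ.le
  have hs : (n : ℝ) < β * p₁ - 1 := by
    rw [div_lt_iff₀ hp₁0] at hβ; linarith
  let ι := {k : Fin n → ℕ // 2 ≤ ∑ j, k j} × Fin n
  let w : ι → ℝ := fun x => ((∑ j, x.1.1 j : ℕ) : ℝ) + 1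
  have hw1 : ∀ x, 1 ≤ w x := fun x => by
    simp only [w]
    linarith [Nat.cast_nonneg (α := ℝ) (∑ j, x.1.1 j)]
  have hsum : Summable fun x : ι => (w x) ^ (-(β * p₁ - 1)) := by
    have h1 := (summable_sum_add_one_rpow_neg hs).subtype {k : Fin n → ℕ | 2 ≤ ∑ j, k j}
    have h2 : Summable fun _ : Fin n => (1 : ℝ) := Summable.of_finite
    have h3 := h1.mul_of_nonneg h2 (fun k => by simp only [Function.comp]; positivity)
      (fun _ => zero_le_one)
    exact h3.congr fun x => mul_one _
  set F : ℝ≥0∞ := ∑' x : ι, ENNReal.ofReal ((w x) ^ (-(β * p₁ - 1))) with hF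
  have hFtop : F ≠ ∞ := hsum.tsum_ofReal_ne_top
  have hlim : Filter.Tendsto (fun L : ℕ => ENNReal.ofReal (c₂ * (L : ℝ) ^ (-(p - p₁))) * F)
      Filter.atTop (nhds 0) := by
    have h1 : Filter.Tendsto (fun L : ℕ => c₂ * (L : ℝ) ^ (-(p - p₁))) Filter.atTop
        (nhds (c₂ * 0)) :=
      ((tendsto_rpow_neg_atTop (by linarith)).comp tendsto_natCast_atTop_atTop).const_mul c₂
    have h2 := ENNReal.Tendsto.mul_const (ENNReal.tendsto_ofReal h1) (Or.inr hFtop)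
    simpa using h2
  have hexp : Filter.Tendsto (fun L : ℕ => Real.exp (-(L : ℝ))) Filter.atTop (nhds 0) :=
    Real.tendsto_exp_neg_atTop_nhds_zero.comp tendsto_natCast_atTop_atTop
  obtain ⟨L, hLε, hLc, hLm, hL1⟩ := ((hlim.eventually_le_const (pos_iff_ne_zero.2 hε)).and
    ((hexp.eventually_le_const hc₁).and ((Filter.eventually_ge_atTop m).and
      (Filter.eventually_ge_atTop 1)))).exists
  have hL0 : (0 : ℝ) < L := by exact_mod_cast hL1
  let M : ι → ℕ := fun x => ⌈(w x) ^ β⌉₊ + L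
  refine ⟨ι, inferInstance, fun x => {lam | (∀ j, 1 / R < ‖lam j‖ ∧ ‖lam j‖ < R) ∧
      ‖(∏ j, lam j ^ x.1.1 j) - lam x.2‖ < Real.exp (-(3 * M x))},
    fun x => c₂ * w x, M, ?_, fun x => ⟨?_, ?_, ?_, ?_⟩, ?_⟩
  · rintro lam ⟨hlam, hR⟩
    by_contra hnot
    refine hlam (brjuno_of_exp_neg_le hn hβ0 hβ1 L fun k i hk => ?_)
    by_contra! hlt
    exact hnot (mem_iUnion.2 ⟨(⟨k, hk⟩, i), hR, hlt⟩)
  · simp only [ofPred_and, ofPred_forall]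
    refine (isOpen_iInter_of_finite fun j => ?_).inter ?_
    · exact (isOpen_lt continuous_const (by fun_prop)).inter
        (isOpen_lt (by fun_prop) continuous_const)
    · exact isOpen_lt (by fun_prop) continuous_const
  · exact mul_pos hc₂ (by linarith [hw1 x])
  · exact hLm.trans (Nat.le_add_left _ _)
  · refine hcov x.1.1 x.2 (M x) _ x.1.2 (Real.exp_pos _).le ?_
    -- one factor `e^{-M} ≤ e^{-L}` of the width is used to absorb the constant `c₁`
    have h1 : Real.exp (-(3 * M x)) = Real.exp (-(M x : ℝ)) * Real.exp (-(2 * M x)) := by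
      rw [← Real.exp_add]; congr 1; ring
    rw [h1]
    gcongr
    refine le_trans (Real.exp_le_exp.2 (neg_le_neg ?_)) hLc
    exact_mod_cast Nat.le_add_left _ _
  · refine le_trans ?_ hLε
    rw [hF, ← ENNReal.tsum_mul_left]
    refine ENNReal.tsum_le_tsum fun x => ?_
    rw [← ENNReal.ofReal_mul (by positivity)]
    apply ENNReal.ofReal_le_ofReal
    have hw0 : 0 < w x := by linarith [hw1 x]
    have hM : (w x) ^ (β * p₁) * (L : ℝ) ^ (p - p₁) ≤ (M x : ℝ) ^ p := by
      have e1 : (w x) ^ β ≤ M x := by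
        simp only [M]; push_cast
        linarith [Nat.le_ceil ((w x) ^ β)]
      have e2 : (L : ℝ) ≤ M x := by exact_mod_cast Nat.le_add_left _ _
      have e3 : (0 : ℝ) < M x := hL0.trans_le e2
      calc (w x) ^ (β * p₁) * (L : ℝ) ^ (p - p₁) = ((w x) ^ β) ^ p₁ * (L : ℝ) ^ (p - p₁) := by
            rw [Real.rpow_mul hw0.le]
        _ ≤ (M x : ℝ) ^ p₁ * (M x : ℝ) ^ (p - p₁) := by
            gcongr
        _ = (M x : ℝ) ^ p := by rw [← Real.rpow_add e3]; ring_nf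
    calc c₂ * w x / (M x : ℝ) ^ p
        ≤ c₂ * w x / ((w x) ^ (β * p₁) * (L : ℝ) ^ (p - p₁)) := by gcongr
      _ = c₂ * (L : ℝ) ^ (-(p - p₁)) * (w x) ^ (-(β * p₁ - 1)) := by
        rw [Real.rpow_neg hL0.le, neg_sub, Real.rpow_sub hw0, Real.rpow_one]
        field_simp

/-- The union over `R` of the regions `1 / R < |λ_j| < R` misses only the coordinate hyperplanes,
which are themselves null. -/
lemma tubeNull_setOf_not_brjuno {n : ℕ} (hn : 1 ≤ n) {p : ℝ} (hp : (n : ℝ) + 1 < p) :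
    TubeNull (2 * n - 2) p {lam : EuclideanSpace ℂ (Fin n) | ¬ Brjuno lam} := by
  have hn0 : (0 : ℝ) ≤ n := Nat.cast_nonneg n
  refine (TubeNull.iUnion (κ := (ℕ × Fin n) ⊕ ℕ) (S := Sum.elim
    (fun x => {lam | lam x.2 = 0 ∧ ∀ j, ‖lam j‖ < x.1 + 1})
    (fun R => {lam | ¬ Brjuno lam ∧ ∀ j, 1 / ((R : ℝ) + 1) < ‖lam j‖ ∧ ‖lam j‖ < R + 1}))
    ?_).mono ?_
  · rintro (⟨R, i⟩ | R)
    · exact tubeNull_coordinate_hyperplane i (by positivity) (by linarith)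
    · exact tubeNull_not_brjuno_of_annulus hn (by linarith [Nat.cast_nonneg (α := ℝ) R]) hp
  · intro lam hlam
    obtain ⟨R₁, hR₁⟩ : ∃ R : ℕ, ∀ j, ‖lam j‖ ≤ R := by
      obtain ⟨R, hR⟩ := exists_nat_ge (∑ j, ‖lam j‖)
      exact ⟨R, fun j => (Finset.single_le_sum (f := fun j => ‖lam j‖)
        (fun _ _ => norm_nonneg _) (Finset.mem_univ j)).trans hR⟩
    by_cases h0 : ∃ i, lam i = 0
    · obtain ⟨i, hi⟩ := h0
      exact mem_iUnion.2 ⟨Sum.inl (R₁, i), hi, fun j => (hR₁ j).trans_lt (lt_add_one _)⟩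
    · push Not at h0
      obtain ⟨R₂, hR₂⟩ : ∃ R : ℕ, ∀ j, ‖lam j‖⁻¹ ≤ R := by
        obtain ⟨R, hR⟩ := exists_nat_ge (∑ j, ‖lam j‖⁻¹)
        exact ⟨R, fun j => (Finset.single_le_sum (f := fun j => ‖lam j‖⁻¹)
          (fun _ _ => by positivity) (Finset.mem_univ j)).trans hR⟩
      refine mem_iUnion.2 ⟨Sum.inr (R₁ + R₂), hlam, fun j => ⟨?_, ?_⟩⟩
      · have hj := norm_pos_iff.2 (h0 j)
        rw [one_div, inv_lt_comm₀ (by positivity) hj]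
        have := hR₂ j
        push_cast
        linarith [Nat.cast_nonneg (α := ℝ) R₁]
      · have := hR₁ j
        push_cast
        linarith [Nat.cast_nonneg (α := ℝ) R₂]

end BrjunoCapacity

theorem mainTheorem1 (n : ℕ) (hn : 2 ≤ n) (E : Set (EuclideanSpace ℂ (Fin n)))
    (hE : E = {lam | ¬ BrjunoCapacity.Brjuno lam}) :
    (∀ σ : ℝ, (n : ℝ) < σ →
      BrjunoCapacity.innerCapacity σ E = 0 ∧ BrjunoCapacity.outerCapacity σ E = 0) ∧
    (∀ δ : ℝ, (n : ℝ) + 1 < δ →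
      BrjunoCapacity.hausdorffMeasure (BrjunoCapacity.gauge n δ) E = 0) := by
  subst hE
  constructor
  · intro σ hσ
    have hσ0 : 0 ≤ σ := (Nat.cast_nonneg n).trans hσ.le
    exact (BrjunoCapacity.tubeNull_setOf_not_brjuno (by omega)
      (by linarith)).capacity_eq_zero hn hσ0
  · intro δ hδ
    exact (BrjunoCapacity.tubeNull_setOf_not_brjuno (by omega) hδ).hausdorffMeasure_eq_zero hn
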